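/- **Setting.** There are aggregate units $k\in\{1,\dots,K\}$ (unit $1$ is treated, the others are controls), and periods $t\in\{1,\dots,T\}$ with $T\ge 2$; $T_0=T-1$ is the last pre-treatment period and $T$ the only post-treatment period. Individuals have potential outcomes with finite means in each cell $(k,t)$; $\mu_t^k(1),\mu_t^k(0)$ denote the cell means with and without treatment. The realized outcome is the treated potential outcome in cell $(1,T)$ and the untreated one in all other cells, so the observed cell means are $\mu_t^k=\mu_t^k(0)+(\mu_t^k(1)-\mu_t^k(0))\mathbf 1\{k=1,t=T\}$. Write $\Delta\mu_t^k=\mu_t^k-\mu_{t-1}^k$ and likewise $\Delta\mu_t^k(0)$, and let $\Delta^{K-2}$ be the set of $\omega=(\omega_2,\dots,\omega_K)$ with $\omega_k\ge 0$, $\sum_k\omega_k=1$. **Assumptions.** (a) *Synthetic parallel trends with nonnegative weights*: there is $\omega\in\Delta^{K-2}$ with $\sum_{k=2}^K\omega_k\Delta\mu_t^k(0)=\Delta\mu_t^1(0)$ for all $t\in\{2,\dots,T\}$. (b) *Sampling*, for a constant $\epsilon>0$; for each $n$ one of the following samples of size $n$ is available, under the same scheme for all $n$. *Panel*: $(Y_{i1},\dots,Y_{iT},G_i)$,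 $i\le n$, are iid from a law $\mathbb P$, where $G_i$ is the unit of individual $i$, $p_k=\mathbb P(G_i=k)\ge\epsilon$ for all $k$, and $\mu_t^k(d)=\mathbb E[Y_{it}(d)\mid G_i=k]$. *Repeated cross-sections (RCS)*: one observes $(Y_i,G_i,T_i)$, $i\le n$, where $T_i$ is the period of individual $i$; $\pi_t\ge0$ with $\sum_t\pi_t=1$, $\mathbb P_t$ is the law of $(Y_i,G_i)$ in period $t$, $\mathbb P(Y_i\le y,G_i=k,T_i=t)=\pi_t\mathbb P_t(Y_i\le y,G_i=k)$ defines the pooled law $\mathbb P$, $\pi_{kt}=\pi_t\mathbb P_t(G_i=k)\ge\epsilon$ for all $k,t$, and $\mu_t^k(d)=\mathbb E[Y_i(d)\mid G_i=k,T_i=t]$; either the $(Y_i,G_i,T_i)$ are iid from $\mathbb P$, or the $T_i$ are fixed with $\#\{i\le n:T_i=t\}/n\to\pi_t$ for each $t$ and the $(Y_i,G_i)$ are independent with law $\mathbb P_{T_i}$. (c) *Moments*: for a constant $C<\infty$, $0<\mathbb E[Y_{it}^2]<C$ for all $t$ (panel), or $0<\mathbb E[Y_i^2]<C$ under $\mathbb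 P$ (RCS). **Identified set.** $\mathcal T^+$ is the set of $\mu_T^1(1)-\mu$ over all $\mu\in\mathbb R$ such that $\mu-\mu_{T_0}^1(0)=\sum_{k=2}^K\omega_k\Delta\mu_T^k(0)$ for some $\omega\in\Delta^{K-2}$ with $\sum_{k=2}^K\omega_k\Delta\mu_t^k(0)=\Delta\mu_t^1(0)$ for $2\le t\le T_0$. **Confidence set.** For a table $\nu=(\nu_t^k)$ and $\omega\in\Delta^{K-2}$ let $D_\omega\nu\in\mathbb R^{T_0}$ have entries $\sum_{k=2}^K\omega_k(\nu_t^k-\nu_{t-1}^k)-(\nu_t^1-\nu_{t-1}^1)$, $t=2,\dots,T$, and let $m_\tau(\omega;\nu)=D_\omega\nu+\tau e$, where $e$ is the last standard basis vector of $\mathbb R^{T_0}$. Let $\hat\mu_t^k$ be the sample mean of the outcomes of cell $(k,t)$, that is, of the $Y_{it}$ with $G_i=k$ (panel) or of the $Y_i$ with $G_i=k,T_i=t$ (RCS), and put $\hat Q_n(\tau)=\min_{\omega\in\Delta^{K-2}}\|m_\tau(\omega;\hat\mu)\|^2$. Let $Z$ be a centered Gaussian vector with the covariance matrix, under $\mathbb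 P$, of the vector $\tilde Y$ whose entry for the cell $(k,t)$ is $$\frac{\mathbf 1\{G=k\}Y_t}{p_k}-\frac{\mathbb E[\mathbf 1\{G=k\}Y_t]\,\mathbf 1\{G=k\}}{p_k^2}\ \text{(panel)},\qquad \frac{\mathbf 1\{G=k,T=t\}Y}{\pi_{kt}}-\frac{\mathbb E[\mathbf 1\{G=k,T=t\}Y]\,\mathbf 1\{G=k,T=t\}}{\pi_{kt}^2}\ \text{(RCS)}.$$ Let $\psi(\tau)=\min\{\,2\,m_\tau(\omega;\mu)'D_\omega Z:\ \omega\in\arg\min_{\Delta^{K-2}}\|m_\tau(\cdot;\mu)\|^2\}$, which is the Hadamard directional derivative of the minimum over $\Delta^{K-2}$, applied to the limiting Gaussian process of $\sqrt n(\|m_\tau(\cdot;\hat\mu)\|^2-\|m_\tau(\cdot;\mu)\|^2)$; let $c_\beta(\tau)$ be the $\beta$-quantile of $\psi(\tau)$. For $\alpha\in(0,1)$ and a small uniformity factor $\varsigma>0$ let $$\mathcal{CS}_n^{(1-\alpha)}=\{\tau\in\mathbb R:\ \sqrt n\,\hat Q_n(\tau)\le c_{1-\alpha+\varsigma}(\tau)+\varsigma\}.$$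 **Theorem.** Under (a), (b) and (c), for every $\alpha\in(0,1)$ and every $\varsigma\in(0,\alpha)$, $$\lim_{n\to\infty}\mathbb P\bigl(\tilde\tau\in\mathcal{CS}_n^{(1-\alpha)}\bigr)\ \text{exists and is}\ \ge 1-\alpha\qquad\text{for every }\tilde\tau\in\mathcal T^+.$$ -/

import Mathlib

open MeasureTheory ProbabilityTheory Filter Topology

noncomputable section

namespace SynthPT

/-! ### Indices

There are `J + 1` aggregate units: unit `0` is treated and the units `j.succ`, `j : Fin J`, are the
controls. There are `m + 2` periods; the last one is the only post-treatment period and the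
`m + 1` others are pre-treatment periods. There are `m + 1` period-to-period trends; the
last one is the trend from the last pre-treatment period to the post-treatment period. -/

abbrev AggUnit (J : ℕ) := Fin (J + 1)

abbrev Period (m : ℕ) := Fin (m + 2)

/-- A table of (population or sample) cell means. -/
abbrev MeanTable (J m : ℕ) := AggUnit J → Period m → ℝ

variable {J m : ℕ}

/-- The cell (treated unit, post-treatment period) is the only treated one. -/
def IsTreated (k : AggUnit J) (t : Period m) : Prop := k = 0 ∧ t = Fin.last (m + 1)

instance (k : AggUnit J) (t : Period m) : Decidable (IsTreated k t) :=
  inferInstanceAs (Decidable (_ ∧ _))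

/-! ### Identification -/

/-- `trend μ k s` is the change of the mean of unit `k` from period `s` to period `s + 1`. -/
def trend (μ : MeanTable J m) (k : AggUnit J) (s : Fin (m + 1)) : ℝ :=
  μ k s.succ - μ k s.castSucc

/-- Synthetic parallel trends with nonnegative weights, for the table `μ0` of untreated means. -/
def SyntheticParallelTrends (μ0 : MeanTable J m) : Prop :=
  ∃ ω : Fin J → ℝ, (∀ j, 0 ≤ ω j) ∧ ∑ j, ω j = 1 ∧
    ∀ s : Fin (m + 1), ∑ j, ω j * trend μ0 j.succ s = trend μ0 0 s

/-- Controls' pre-treatment trends. -/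
def Apre (μ0 : MeanTable J m) : Matrix (Fin m) (Fin J) ℝ :=
  Matrix.of fun s j => trend μ0 j.succ s.castSucc

/-- The treated unit's pre-treatment trends. -/
def bpre (μ0 : MeanTable J m) : Fin m → ℝ := fun s => trend μ0 0 s.castSucc

/-- Controls' post-treatment trends. -/
def apost (μ0 : MeanTable J m) : Fin J → ℝ := fun j => trend μ0 j.succ (Fin.last m)

/-- Identified set for the treated unit's untreated post-treatment trend, with nonnegative
weights. -/
def trendSet (μ0 : MeanTable J m) : Set ℝ :=
  {x | ∃ ω : Fin J → ℝ, (∀ j, 0 ≤ ω j) ∧ ∑ j, ω j = 1 ∧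
    Matrix.mulVec (Apre μ0) ω = bpre μ0 ∧ x = apost μ0 ⬝ᵥ ω}

/-- Identified set for the treatment effect on the treated unit in the post-treatment period:
observed treated mean minus a candidate untreated mean whose trend lies in `trendSet`. -/
def effectSet (μ0 μ1 : MeanTable J m) : Set ℝ :=
  {τ | ∃ x : ℝ, x - μ0 0 (Fin.last m).castSucc ∈ trendSet μ0 ∧
    τ = μ1 0 (Fin.last (m + 1)) - x}

/-- Observed aggregate means. -/
def obsMean (μ0 μ1 : MeanTable J m) : MeanTable J m := fun k t =>
  if IsTreated k t then μ1 k t else μ0 k t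

/-! ### Moment function and profiled criterion -/

/-- The matrix `A` of controls' trends (pre-treatment rows, then the post-treatment row). -/
def trendA (μ : MeanTable J m) : Matrix (Fin (m + 1)) (Fin J) ℝ :=
  Matrix.of fun s j => trend μ j.succ s

/-- The vector `b` of the treated unit's trends. -/
def trendb (μ : MeanTable J m) : Fin (m + 1) → ℝ := fun s => trend μ 0 s

/-- `A ω - b`, for the trends `A`, `b` formed from a table `μ`; it is linear in `μ`. -/
def imbalance (ω : Fin J → ℝ) (μ : MeanTable J m) : Fin (m + 1) → ℝ :=
  Matrix.mulVec (trendA μ) ω - trendb μ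

/-- The moment function `A ω - b + τ e`, where `e` is the last standard basis vector. -/
def momentFn (τ : ℝ) (ω : Fin J → ℝ) (μ : MeanTable J m) : Fin (m + 1) → ℝ :=
  imbalance ω μ + τ • Pi.single (Fin.last m) 1

/-- Squared Euclidean norm of the moment function. -/
def momentSq (τ : ℝ) (μ : MeanTable J m) (ω : Fin J → ℝ) : ℝ :=
  momentFn τ ω μ ⬝ᵥ momentFn τ ω μ

/-- Profiled criterion: minimum of the squared moment function over the simplex. -/
def profiled (τ : ℝ) (μ : MeanTable J m) : ℝ :=
  sInf (momentSq τ μ '' stdSimplex ℝ (Fin J))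

/-! ### Limit distribution and critical value -/

/-- Minimizers of `f` over the simplex. -/
def simplexArgmin (f : (Fin J → ℝ) → ℝ) : Set (Fin J → ℝ) :=
  {ω | ω ∈ stdSimplex ℝ (Fin J) ∧ ∀ ω' ∈ stdSimplex ℝ (Fin J), f ω ≤ f ω'}

/-- Hadamard directional derivative at `f`, in the direction `g`, of the minimum over the simplex:
the minimum of `g` over the minimizers of `f`. -/
def dirDeriv (f g : (Fin J → ℝ) → ℝ) : ℝ := sInf (g '' simplexArgmin f)

/-- The limit process `ω ↦ 2 (A ω - b + τ e)' (A_z ω - b_z)` of the rescaled squared moment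
function, as a function of a realization `z` of the limit of the rescaled cell means. -/
def limitProcess (τ : ℝ) (μ : MeanTable J m) (z : EuclideanSpace ℝ (AggUnit J × Period m))
    (ω : Fin J → ℝ) : ℝ :=
  2 * (momentFn τ ω μ ⬝ᵥ imbalance ω (fun k t => z (k, t)))

/-- The limit variable `ψ(τ)` of `√n (Q̂(τ) - Q(τ))`. -/
def limitVar (τ : ℝ) (μ : MeanTable J m) (z : EuclideanSpace ℝ (AggUnit J × Period m)) : ℝ :=
  dirDeriv (momentSq τ μ) (limitProcess τ μ z)

/-- The `β`-quantile of `ψ(τ)`, when the rescaled cell means have limit law `N(0, V)`. -/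
def critValue (τ : ℝ) (μ : MeanTable J m)
    (V : Matrix (AggUnit J × Period m) (AggUnit J × Period m) ℝ) (β : ℝ) : ℝ :=
  sInf {c : ℝ | β ≤ (multivariateGaussian 0 V).real {z | limitVar τ μ z ≤ c}}

/-- Level `1 - α` confidence set, with infinitesimal uniformity factor `ς`, for a sample of size
`n` with sample cell means `μhat`; the population has cell means `μ` and limit covariance `V`. -/
def confSet (μ : MeanTable J m) (V : Matrix (AggUnit J × Period m) (AggUnit J × Period m) ℝ)
    (α ς : ℝ) (n : ℕ) (μhat : MeanTable J m) : Set ℝ :=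
  {τ | Real.sqrt n * profiled τ μhat ≤ critValue τ μ V (1 - α + ς) + ς}

/-- For every `τ ∈ S`, the probability that the random set `CS n` contains `τ` has a limit as
`n → ∞`, and this limit is at least `level`. -/
def CoversPointwise {Ω : ℕ → Type*} [∀ n, MeasurableSpace (Ω n)] (Pr : ∀ n, Measure (Ω n))
    (CS : ∀ n, Ω n → Set ℝ) (S : Set ℝ) (level : ℝ) : Prop :=
  ∀ τ ∈ S, ∃ L : ℝ,
    Tendsto (fun n => (Pr n).real {x | τ ∈ CS n x}) atTop (𝓝 L) ∧ level ≤ L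

/-! ### Panel data

An individual is `(Y(0), Y(1), G)`: the paths of untreated and of treated potential outcomes, and
the aggregate unit the individual belongs to. An observation is `(Y, G)`. -/

abbrev PanelInd (J m : ℕ) := (Period m → ℝ) × (Period m → ℝ) × AggUnit J

abbrev PanelObs (J m : ℕ) := (Period m → ℝ) × AggUnit J

/-- Realized outcomes and aggregate unit of an individual. -/
def panelObserve (x : PanelInd J m) : PanelObs J m :=
  (fun t => if IsTreated x.2.2 t then x.2.1 t else x.1 t, x.2.2)

/-- Distribution of one observation. -/
def panelLaw (P : Measure (PanelInd J m)) : Measure (PanelObs J m) := P.map panelObserve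

/-- The untreated means `E[Y_t(0) | G = k]`. -/
def panelMean0 (P : Measure (PanelInd J m)) : MeanTable J m := fun k t =>
  ∫ x, x.1 t ∂(cond P {x | x.2.2 = k})

/-- The treated means `E[Y_t(1) | G = k]`. -/
def panelMean1 (P : Measure (PanelInd J m)) : MeanTable J m := fun k t =>
  ∫ x, x.2.1 t ∂(cond P {x | x.2.2 = k})

/-- Sample cell means. -/
def panelMeanHat {n : ℕ} (x : Fin n → PanelObs J m) : MeanTable J m := fun k t =>
  let phat : ℝ := (1 / n) * ∑ i, if (x i).2 = k then 1 else 0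
  (1 / n) * ∑ i, (1 / phat) * if (x i).2 = k then (x i).1 t else 0

/-- Influence function of the sample mean of the cell `c = (k, t)`, for the law `Q` of one
observation. -/
def panelScore (Q : Measure (PanelObs J m)) (c : AggUnit J × Period m) (x : PanelObs J m) : ℝ :=
  let p : ℝ := Q.real {y | y.2 = c.1}
  (if x.2 = c.1 then x.1 c.2 else 0) / p
    - (∫ y, (if y.2 = c.1 then y.1 c.2 else 0) ∂Q) * (if x.2 = c.1 then 1 else 0) / p ^ 2

/-- Limit covariance of the rescaled sample cell means. -/
def panelCov (P : Measure (PanelInd J m)) :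
    Matrix (AggUnit J × Period m) (AggUnit J × Period m) ℝ :=
  Matrix.of fun c d => covariance (panelScore (panelLaw P) c) (panelScore (panelLaw P) d)
    (panelLaw P)

/-- The confidence set computed from a panel of size `n`. -/
def panelCS (P : Measure (PanelInd J m)) (α ς : ℝ) (n : ℕ) (x : Fin n → PanelObs J m) : Set ℝ :=
  confSet (obsMean (panelMean0 P) (panelMean1 P)) (panelCov P) α ς n (panelMeanHat x)

/-! ### Repeated cross-sections

An individual who is observed in period `t` is `(Y(0), Y(1), G)`: the potential outcomes in that
period and the aggregate unit. Individuals of stratum `t` have distribution `P t`; stratum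
`t` has population share `π t`. An observation is `(Y, G, T)`. -/

abbrev RCSInd (J : ℕ) := ℝ × ℝ × AggUnit J

abbrev RCSObs (J m : ℕ) := ℝ × AggUnit J × Period m

/-- Realized outcome, aggregate unit and period of an individual observed in period `t`. -/
def rcsObserve (t : Period m) (x : RCSInd J) : RCSObs J m :=
  (if IsTreated x.2.2 t then x.2.1 else x.1, x.2.2, t)

/-- Pooled distribution of one observation: the period is `t` with probability `π t`. -/
def rcsLaw (π : Period m → ℝ) (P : Period m → Measure (RCSInd J)) : Measure (RCSObs J m) :=
  ∑ t, ENNReal.ofReal (π t) • (P t).map (rcsObserve t)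

/-- The untreated means `E[Y(0) | G = k, T = t]`. -/
def rcsMean0 (P : Period m → Measure (RCSInd J)) : MeanTable J m := fun k t =>
  ∫ x, x.1 ∂(cond (P t) {x | x.2.2 = k})

/-- The treated means `E[Y(1) | G = k, T = t]`. -/
def rcsMean1 (P : Period m → Measure (RCSInd J)) : MeanTable J m := fun k t =>
  ∫ x, x.2.1 ∂(cond (P t) {x | x.2.2 = k})

/-- Sample cell means. -/
def rcsMeanHat {n : ℕ} (x : Fin n → RCSObs J m) : MeanTable J m := fun k t =>
  let pihat : ℝ := (1 / n) * ∑ i, if (x i).2 = (k, t) then 1 else 0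
  (1 / n) * ∑ i, (1 / pihat) * if (x i).2 = (k, t) then (x i).1 else 0

/-- Influence function of the sample mean of the cell `c = (k, t)`, for the pooled law `Q` of one
observation. -/
def rcsScore (Q : Measure (RCSObs J m)) (c : AggUnit J × Period m) (x : RCSObs J m) : ℝ :=
  let p : ℝ := Q.real {y | y.2 = c}
  (if x.2 = c then x.1 else 0) / p
    - (∫ y, (if y.2 = c then y.1 else 0) ∂Q) * (if x.2 = c then 1 else 0) / p ^ 2

/-- Limit covariance of the rescaled sample cell means. -/
def rcsCov (π : Period m → ℝ) (P : Period m → Measure (RCSInd J)) :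
    Matrix (AggUnit J × Period m) (AggUnit J × Period m) ℝ :=
  Matrix.of fun c d => covariance (rcsScore (rcsLaw π P) c) (rcsScore (rcsLaw π P) d)
    (rcsLaw π P)

/-- The confidence set computed from a repeated cross-section sample of size `n`. -/
def rcsCS (π : Period m → ℝ) (P : Period m → Measure (RCSInd J)) (α ς : ℝ) (n : ℕ)
    (x : Fin n → RCSObs J m) : Set ℝ :=
  confSet (obsMean (rcsMean0 P) (rcsMean1 P)) (rcsCov π P) α ς n (rcsMeanHat x)

/-! ### Sampling schemes -/

/-- `X` is an i.i.d. sample of size `n` from the distribution `Q`. -/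
def IsIIDSample {Ω E : Type*} [MeasurableSpace Ω] [MeasurableSpace E] {n : ℕ}
    (Pr : Measure Ω) (X : Fin n → Ω → E) (Q : Measure E) : Prop :=
  iIndepFun X Pr ∧ ∀ i, HasLaw (X i) Q Pr

/-- `X` is a stratified sample: the period `T i` of the `i`-th observation is fixed, observations
are independent, and within stratum `t` they have the distribution of an observation of an
individual from `P t`. -/
def IsStratifiedSample {Ω : Type*} [MeasurableSpace Ω] {n : ℕ} (Pr : Measure Ω)
    (X : Fin n → Ω → RCSObs J m) (T : Fin n → Period m) (P : Period m → Measure (RCSInd J)) :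
    Prop :=
  iIndepFun X Pr ∧ ∀ i, HasLaw (X i) ((P (T i)).map (rcsObserve (T i))) Pr

end SynthPT

end

open SynthPT

namespace SynthPT

variable {J m : ℕ}

/-! ### The criterion at a point of the identified set -/

/-! At a point `τ` of the identified set some weights `ω` in the simplex annihilate the moment
vector (`exists_momentFn_eq_zero`), so the population criterion is zero. Every minimizer is then a
zero of the moment vector itself. The limit process is the inner product of that vector with a
Gaussian term, so it vanishes on the whole argmin. Thus `ψ(τ)` is identically zero, and so is its
quantile (`critValue_eq_zero`). Membership of `τ` in the confidence set reduces to `√n Q̂(τ) ≤ ς`.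

The sample criterion is at most its value at this fixed `ω`, which is quadratic in the errors of the
cell means (`profiled_le`). It is therefore enough that `√n` times each squared error tends to zero
in probability. Second moments give this through Chebyshev's inequality
(`tendsto_measureReal_cellMean`), with no central limit theorem. Coverage tends to one, whatever the
limit covariance.

Panel data and both repeated cross-section schemes are instances of independent, possibly
non-identically distributed observations, with the outcome centred within each cell. -/

lemma trend_obsMean_succ (μ0 μ1 : MeanTable J m) (j : Fin J) (s : Fin (m + 1)) :
    trend (obsMean μ0 μ1) j.succ s = trend μ0 j.succ s := by
  simp [trend, obsMean, IsTreated, Fin.succ_ne_zero]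

lemma trend_obsMean_zero_castSucc (μ0 μ1 : MeanTable J m) (s : Fin m) :
    trend (obsMean μ0 μ1) 0 s.castSucc = trend μ0 0 s.castSucc := by
  have h : s.castSucc.succ ≠ Fin.last (m + 1) := by
    rw [Fin.succ_castSucc]; exact (Fin.castSucc_lt_last _).ne
  have h' : s.castSucc.castSucc ≠ Fin.last (m + 1) := (Fin.castSucc_lt_last _).ne
  simp only [trend, obsMean]
  rw [if_neg (fun H => h H.2), if_neg (fun H => h' H.2)]

/-- The only trend that involves the treated cell, so the only one that mixes a treated mean with an
untreated one. -/
lemma trend_obsMean_zero_last (μ0 μ1 : MeanTable J m) :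
    trend (obsMean μ0 μ1) 0 (Fin.last m) =
      μ1 0 (Fin.last (m + 1)) - μ0 0 (Fin.last m).castSucc := by
  have h' : (Fin.last m).castSucc ≠ Fin.last (m + 1) := (Fin.castSucc_lt_last _).ne
  simp only [trend, obsMean]
  rw [if_pos ⟨rfl, Fin.succ_last _⟩, if_neg (fun H => h' H.2), Fin.succ_last]

/-- The pre-treatment rows vanish because `ω` matches the pre-trends. In the last row, `τ` is
exactly the gap between the treated unit's observed trend and the counterfactual trend `apost μ0 ⬝ᵥ
ω`. -/
lemma exists_momentFn_eq_zero {μ0 μ1 : MeanTable J m} {τ : ℝ} (hτ : τ ∈ effectSet μ0 μ1) :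
    ∃ ω ∈ stdSimplex ℝ (Fin J), momentFn τ ω (obsMean μ0 μ1) = 0 := by
  obtain ⟨x, ⟨ω, h0, h1, hpre, hpost⟩, rfl⟩ := hτ
  refine ⟨ω, ⟨h0, h1⟩, ?_⟩
  funext s
  refine Fin.lastCases ?_ (fun s => ?_) s
  · have hA : (trendA (obsMean μ0 μ1)).mulVec ω (Fin.last m) = apost μ0 ⬝ᵥ ω := by
      simp [Matrix.mulVec, dotProduct, trendA, apost, trend_obsMean_succ]
    simp only [momentFn, imbalance, Pi.add_apply, Pi.sub_apply, Pi.smul_apply, Pi.single_eq_same,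
      hA, ← hpost, trendb, trend_obsMean_zero_last, Pi.zero_apply, smul_eq_mul]
    ring
  · have hA : (trendA (obsMean μ0 μ1)).mulVec ω s.castSucc = (Apre μ0).mulVec ω s := by
      simp [Matrix.mulVec, dotProduct, trendA, Apre, trend_obsMean_succ]
    have hne : s.castSucc ≠ Fin.last m := (Fin.castSucc_lt_last _).ne
    simp [momentFn, imbalance, hA, hpre, trendb, trend_obsMean_zero_castSucc, bpre, hne]

lemma momentSq_nonneg (τ : ℝ) (μ : MeanTable J m) (ω : Fin J → ℝ) : 0 ≤ momentSq τ μ ω :=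
  Finset.sum_nonneg (s := Finset.univ) (f := fun s => momentFn τ ω μ s * momentFn τ ω μ s)
    fun _ _ => mul_self_nonneg _

lemma momentSq_eq_zero_iff {τ : ℝ} {μ : MeanTable J m} {ω : Fin J → ℝ} :
    momentSq τ μ ω = 0 ↔ momentFn τ ω μ = 0 :=
  dotProduct_self_eq_zero

/-- Where the population criterion vanishes, the limit variable is degenerate at zero. -/
lemma limitVar_eq_zero {τ : ℝ} {μ : MeanTable J m} {ω : Fin J → ℝ}
    (hω : ω ∈ stdSimplex ℝ (Fin J)) (h : momentFn τ ω μ = 0)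
    (z : EuclideanSpace ℝ (AggUnit J × Period m)) : limitVar τ μ z = 0 := by
  have hmin : ω ∈ simplexArgmin (momentSq τ μ) :=
    ⟨hω, fun ω' _ => by rw [momentSq_eq_zero_iff.2 h]; exact momentSq_nonneg _ _ _⟩
  -- A minimizer has squared norm zero, so the first factor of the limit process is the zero vector
  -- and the realization `z` is irrelevant.
  have hzero : ∀ ω' ∈ simplexArgmin (momentSq τ μ), limitProcess τ μ z ω' = 0 := by
    intro ω' hω'
    have h0 : momentSq τ μ ω' = 0 :=
      le_antisymm ((hω'.2 ω hω).trans (momentSq_eq_zero_iff.2 h).le) (momentSq_nonneg _ _ _)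
    simp [limitProcess, momentSq_eq_zero_iff.1 h0]
  have himage : limitProcess τ μ z '' simplexArgmin (momentSq τ μ) = {0} := by
    ext c
    constructor
    · rintro ⟨ω', hω', rfl⟩
      exact hzero ω' hω'
    · rintro rfl
      exact ⟨ω, hmin, hzero ω hmin⟩
  rw [limitVar, dirDeriv, himage, csInf_singleton]

/-- The distribution function of the point mass at zero jumps from 0 to 1 at zero. For `β ≤ 0` the
set of admissible `c` would be all of `ℝ`. -/
lemma critValue_eq_zero {τ β : ℝ} {μ : MeanTable J m} {ω : Fin J → ℝ}
    (hω : ω ∈ stdSimplex ℝ (Fin J)) (h : momentFn τ ω μ = 0)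
    (V : Matrix (AggUnit J × Period m) (AggUnit J × Period m) ℝ) (hβ0 : 0 < β) (hβ1 : β ≤ 1) :
    critValue τ μ V β = 0 := by
  have hset : {c : ℝ | β ≤ (multivariateGaussian 0 V).real {z | limitVar τ μ z ≤ c}}
      = Set.Ici 0 := by
    ext c
    simp only [limitVar_eq_zero hω h, Set.mem_ofPred_eq, Set.mem_Ici]
    by_cases hc : 0 ≤ c
    · simp [hc, hβ1]
    · simp [hc, hβ0]
  rw [critValue, hset, csInf_Ici]

lemma abs_trend_sub_le {μ ν : MeanTable J m} {η : ℝ} (h : ∀ k t, |ν k t - μ k t| ≤ η)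
    (k : AggUnit J) (s : Fin (m + 1)) : |trend ν k s - trend μ k s| ≤ 2 * η := by
  have h1 := abs_le.1 (h k s.succ)
  have h2 := abs_le.1 (h k s.castSucc)
  rw [abs_le, trend, trend]
  constructor <;> linarith [h1.1, h1.2, h2.1, h2.2]

/-- The moment function is affine in the table and vanishes at `μ`, so its entries at `ν` are linear
in the errors. Squaring makes the bound quadratic, which is what beats the factor `√n`. -/
lemma profiled_le {τ : ℝ} {μ ν : MeanTable J m} {ω : Fin J → ℝ} {η : ℝ}
    (hω : ω ∈ stdSimplex ℝ (Fin J)) (h : momentFn τ ω μ = 0)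
    (hη : ∀ k t, |ν k t - μ k t| ≤ η) : profiled τ ν ≤ (m + 1) * (4 * η) ^ 2 := by
  have hbdd : BddBelow (momentSq τ ν '' stdSimplex ℝ (Fin J)) :=
    ⟨0, by rintro _ ⟨ω', _, rfl⟩; exact momentSq_nonneg _ _ _⟩
  refine (csInf_le hbdd ⟨ω, hω, rfl⟩).trans ?_
  have hentry : ∀ s, |momentFn τ ω ν s| ≤ 4 * η := by
    intro s
    have hdiff : momentFn τ ω ν s
        = ∑ j, ω j * (trend ν j.succ s - trend μ j.succ s) - (trend ν 0 s - trend μ 0 s) := by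
      have h0 := congrFun h s
      -- Subtracting the zero moment at `μ` cancels the `τ e` term.
      rw [← sub_zero (momentFn τ ω ν s), ← Pi.zero_apply (M := fun _ => ℝ) s, ← h0]
      simp only [momentFn, imbalance, Matrix.mulVec, dotProduct, trendA, trendb, Pi.add_apply,
        Pi.sub_apply, Matrix.of_apply, mul_sub, Finset.sum_sub_distrib]
      simp only [mul_comm (ω _)]
      ring
    have hsum : |∑ j, ω j * (trend ν j.succ s - trend μ j.succ s)| ≤ 2 * η :=
      calc |∑ j, ω j * (trend ν j.succ s - trend μ j.succ s)|
          ≤ ∑ j, |ω j * (trend ν j.succ s - trend μ j.succ s)| := Finset.abs_sum_le_sum_abs _ _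
        _ ≤ ∑ j, ω j * (2 * η) := Finset.sum_le_sum fun j _ => by
            rw [abs_mul, abs_of_nonneg (hω.1 j)]
            exact mul_le_mul_of_nonneg_left (abs_trend_sub_le hη _ _) (hω.1 j)
        _ = 2 * η := by rw [← Finset.sum_mul, hω.2, one_mul]
    -- The bound `4 * η` is `2 * η` from the weighted controls plus `2 * η` from the treated unit.
    rw [hdiff]
    exact (abs_sub _ _).trans (by linarith [abs_trend_sub_le hη 0 s])
  calc momentSq τ ν ω ≤ ∑ _s : Fin (m + 1), (4 * η) ^ 2 := by
        rw [momentSq, dotProduct]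
        refine Finset.sum_le_sum fun s _ => ?_
        rw [← sq]
        exact sq_le_sq' (abs_le.1 (hentry s)).1 (abs_le.1 (hentry s)).2
    _ = (m + 1) * (4 * η) ^ 2 := by simp

/-- If the cell means are estimated at a rate faster than `n ^ (-1/4)`, the confidence set covers
every point of the identified set with probability tending to one. -/
theorem coversPointwise_confSet {μ0 μ1 : MeanTable J m}
    (V : Matrix (AggUnit J × Period m) (AggUnit J × Period m) ℝ) {α ς : ℝ}
    (hα1 : α < 1) (hς0 : 0 < ς) (hςα : ς < α) {Ω : ℕ → Type*} [∀ n, MeasurableSpace (Ω n)]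
    (Pr : ∀ n, Measure (Ω n)) [∀ n, IsProbabilityMeasure (Pr n)]
    (μhat : ∀ n, Ω n → MeanTable J m)
    (h : ∀ k t, ∀ r > 0, Tendsto (fun n => (Pr n).real
      {x | r < Real.sqrt n * (μhat n x k t - obsMean μ0 μ1 k t) ^ 2}) atTop (𝓝 0)) :
    CoversPointwise Pr (fun n x => confSet (obsMean μ0 μ1) V α ς n (μhat n x))
      (effectSet μ0 μ1) (1 - α) := by
  intro τ hτ
  refine ⟨1, ?_, by linarith⟩
  obtain ⟨ω, hω, hzero⟩ := exists_momentFn_eq_zero hτ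
  have hm : (0 : ℝ) < m + 1 := by positivity
  -- Chosen so that `√n * ((m + 1) * (4 * η) ^ 2) = ς` when `η ^ 2 = r / √n`.
  set r : ℝ := ς / (16 * (m + 1)) with hr
  have hr0 : 0 < r := by positivity
  have hbound : ∀ n : ℕ, 0 < n →
      1 - ∑ c : AggUnit J × Period m, (Pr n).real
        {x | r < Real.sqrt n * (μhat n x c.1 c.2 - obsMean μ0 μ1 c.1 c.2) ^ 2}
      ≤ (Pr n).real {x | τ ∈ confSet (obsMean μ0 μ1) V α ς n (μhat n x)} := by
    intro n hn
    have hsn : 0 < Real.sqrt n := Real.sqrt_pos.2 (by exact_mod_cast hn)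
    -- Covering the whole space uses only subadditivity, so none of these events has to be
    -- measurable.
    have hcover : (Set.univ : Set (Ω n)) ⊆
        {x | τ ∈ confSet (obsMean μ0 μ1) V α ς n (μhat n x)} ∪
        ⋃ c : AggUnit J × Period m,
          {x | r < Real.sqrt n * (μhat n x c.1 c.2 - obsMean μ0 μ1 c.1 c.2) ^ 2} := by
      intro x _
      by_cases hx : ∃ c : AggUnit J × Period m,
          r < Real.sqrt n * (μhat n x c.1 c.2 - obsMean μ0 μ1 c.1 c.2) ^ 2
      · exact Or.inr (Set.mem_iUnion.2 hx)
      · left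
        push Not at hx
        have hη : ∀ k t, |μhat n x k t - obsMean μ0 μ1 k t| ≤ Real.sqrt (r / Real.sqrt n) := by
          intro k t
          apply Real.abs_le_sqrt
          rw [le_div_iff₀ hsn, mul_comm]
          exact hx (k, t)
        have hle := profiled_le hω hzero hη
        rw [mul_pow, Real.sq_sqrt (by positivity)] at hle
        change Real.sqrt n * profiled τ (μhat n x) ≤ critValue τ _ V (1 - α + ς) + ς
        rw [critValue_eq_zero hω hzero V (by linarith) (by linarith), zero_add]
        calc Real.sqrt n * profiled τ (μhat n x)
            ≤ Real.sqrt n * ((m + 1) * (4 ^ 2 * (r / Real.sqrt n))) := by gcongr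
          _ = ς := by rw [hr]; field_simp; norm_num
    have hone := (measureReal_mono (μ := Pr n) hcover).trans
      ((measureReal_union_le _ _).trans (add_le_add le_rfl (measureReal_iUnion_fintype_le _)))
    rw [probReal_univ] at hone
    linarith
  refine tendsto_of_tendsto_of_tendsto_of_le_of_le' (g := fun n => 1 - ∑ c : AggUnit J × Period m,
    (Pr n).real {x | r < Real.sqrt n * (μhat n x c.1 c.2 - obsMean μ0 μ1 c.1 c.2) ^ 2})
    (h := fun _ => 1) ?_ tendsto_const_nhds ?_ (Eventually.of_forall fun _ => measureReal_le_one)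
  · have hsum := tendsto_finsetSum (Finset.univ : Finset (AggUnit J × Period m))
      (fun c _ => h c.1 c.2 r hr0)
    simpa using hsum.const_sub 1
  · filter_upwards [eventually_gt_atTop 0] with n hn using hbound n hn

/-! ### Convergence of sample cell means -/

section CellMean

variable {E Ω : Type*} [MeasurableSpace E] [MeasurableSpace Ω]

/-- Chebyshev's inequality for a sum of functions of independent observations. -/
lemma measureReal_abs_sum_sub_ge_le {n : ℕ} {Pr : Measure Ω} [IsProbabilityMeasure Pr]
    {X : Fin n → Ω → E} {Q : Fin n → Measure E} (hind : iIndepFun X Pr)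
    (hlaw : ∀ i, HasLaw (X i) (Q i) Pr) {f : E → ℝ} (hf : Measurable f)
    (hf2 : ∀ i, MemLp f 2 (Q i)) {B : ℝ} (hB : ∀ i, ∫ e, f e ^ 2 ∂(Q i) ≤ B) {a : ℝ} (ha : 0 < a) :
    Pr.real {x | a ≤ |∑ i, f (X i x) - ∑ i, ∫ e, f e ∂(Q i)|} ≤ n * B / a ^ 2 := by
  have hmem : ∀ i, MemLp (fun x => f (X i x)) 2 Pr := fun i => by
    have := hf2 i
    rw [← (hlaw i).map_eq] at this
    exact this.comp_of_map (hlaw i).aemeasurable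
  have hmean : ∀ g : E → ℝ, Measurable g → ∀ i, ∫ x, g (X i x) ∂Pr = ∫ e, g e ∂(Q i) :=
    fun g hg i => by
      rw [← (hlaw i).map_eq, integral_map (hlaw i).aemeasurable hg.aestronglyMeasurable]
  have hvar : Var[∑ i, fun x => f (X i x); Pr] ≤ n * B := by
    rw [IndepFun.variance_sum (fun i _ => hmem i)
      (fun i _ j _ hij => (hind.indepFun hij).comp hf hf)]
    -- Each variance is at most the second moment, so the uniform bound `B` needs no centring.
    calc ∑ i, Var[fun x => f (X i x); Pr] ≤ ∑ _i : Fin n, B :=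
          Finset.sum_le_sum fun i _ =>
            (variance_le_expectation_sq (hmem i).1).trans (by
              have := hmean (fun e => f e ^ 2) (hf.pow_const 2) i
              simp only [Pi.pow_apply]
              rw [this]; exact hB i)
      _ = n * B := by simp
  have hint : ∫ x, (∑ i, fun x => f (X i x)) x ∂Pr = ∑ i, ∫ e, f e ∂(Q i) := by
    simp only [Finset.sum_apply]
    rw [integral_finsetSum _ (fun i _ => (hmem i).integrable one_le_two)]
    exact Finset.sum_congr rfl fun i _ => hmean f hf i
  have hch := meas_ge_le_variance_div_sq (memLp_finsetSum' Finset.univ (fun i _ => hmem i)) ha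
    (μ := Pr)
  rw [hint] at hch
  simp only [Finset.sum_apply] at hch
  calc Pr.real {x | a ≤ |∑ i, f (X i x) - ∑ i, ∫ e, f e ∂(Q i)|}
      ≤ Var[∑ i, fun x => f (X i x); Pr] / a ^ 2 :=
        ENNReal.toReal_le_of_le_ofReal (div_nonneg (variance_nonneg _ _) (sq_nonneg a)) hch
    _ ≤ n * B / a ^ 2 := by gcongr

end CellMean

open Classical in
/-- The sample mean of `y` over the observations that fall in `s`. -/
noncomputable def cellMean {E : Type*} (s : Set E) (y : E → ℝ) {n : ℕ} (x : Fin n → E) : ℝ :=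
  (1 / n) * ∑ i, (1 / ((1 / n) * ∑ i, if x i ∈ s then (1 : ℝ) else 0)) *
    if x i ∈ s then y (x i) else 0

/-- Isolates the random denominator: the error is a ratio of two sums of functions of single
observations, to each of which Chebyshev's inequality applies. The hypothesis excludes an empty
cell, where division by zero would give the mean the value 0. -/
lemma cellMean_sub {E : Type*} {s : Set E} {y : E → ℝ} {n : ℕ} {x : Fin n → E} (c : ℝ)
    (h : ∑ i, s.indicator (fun _ => (1 : ℝ)) (x i) ≠ 0) :
    cellMean s y x - c = (∑ i, s.indicator (fun e => y e - c) (x i)) /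
      ∑ i, s.indicator (fun _ => (1 : ℝ)) (x i) := by
  classical
  have hn : (n : ℝ) ≠ 0 := by
    rintro hn
    obtain rfl : n = 0 := by exact_mod_cast hn
    simp at h
  have hsub : ∑ i, s.indicator (fun e => y e - c) (x i)
      = ∑ i, s.indicator y (x i) - c * ∑ i, s.indicator (fun _ => (1 : ℝ)) (x i) := by
    rw [Finset.mul_sum, ← Finset.sum_sub_distrib]
    refine Finset.sum_congr rfl fun i _ => ?_
    by_cases hi : x i ∈ s <;> simp [hi]
  have hcell : cellMean s y x = (1 / n) * ((1 / ((1 / n) *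
      ∑ i, s.indicator (fun _ => (1 : ℝ)) (x i))) * ∑ i, s.indicator y (x i)) := by
    simp only [cellMean, Set.indicator_apply, Finset.mul_sum]
  rw [hcell, hsub]
  field_simp

/-- For independent, not necessarily identically distributed observations, the sample mean of a
cell of asymptotically positive frequency converges faster than `n ^ (-1/4)`. -/
theorem tendsto_measureReal_cellMean {E : Type*} [MeasurableSpace E] {Ω : ℕ → Type*}
    [∀ n, MeasurableSpace (Ω n)] (Pr : ∀ n, Measure (Ω n)) [∀ n, IsProbabilityMeasure (Pr n)]
    {X : ∀ n, Fin n → Ω n → E} {Q : ∀ n, Fin n → Measure E} (hind : ∀ n, iIndepFun (X n) (Pr n))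
    (hlaw : ∀ n i, HasLaw (X n i) (Q n i) (Pr n)) {s : Set E} (hs : MeasurableSet s)
    {y : E → ℝ} (hy : Measurable y) {c B p : ℝ} (hp : 0 < p)
    (hmem : ∀ n i, MemLp (s.indicator fun e => y e - c) 2 (Q n i))
    (hmean : ∀ n i, ∫ e, s.indicator (fun e => y e - c) e ∂(Q n i) = 0)
    (hvar : ∀ n i, ∫ e, s.indicator (fun e => y e - c) e ^ 2 ∂(Q n i) ≤ B)
    (hfreq : Tendsto (fun n : ℕ => (∑ i, (Q n i).real s) / n) atTop (𝓝 p)) {r : ℝ} (hr : 0 < r) :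
    Tendsto (fun n => (Pr n).real
      {x | r < Real.sqrt n * (cellMean s y (fun i => X n i x) - c) ^ 2}) atTop (𝓝 0) := by
  have hQ : ∀ n i, IsProbabilityMeasure (Q n i) := fun n i =>
    (hlaw n i).isProbabilityMeasure_iff.1 inferInstance
  have hmain : ∀ᶠ n : ℕ in atTop, (Pr n).real
      {x | r < Real.sqrt n * (cellMean s y (fun i => X n i x) - c) ^ 2}
      ≤ 16 / p ^ 2 * (n : ℝ)⁻¹ + 4 * B / (r * p ^ 2) * (Real.sqrt n)⁻¹ := by
    -- Once the expected count exceeds `3 * n * p / 4`, a deviation below `n * p / 4` leaves a count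
    -- above `n * p / 2`.
    filter_upwards [eventually_gt_atTop 0, hfreq.eventually (lt_mem_nhds
      (show 3 * p / 4 < p by linarith))] with n hn hfn
    have hn' : (0 : ℝ) < n := by exact_mod_cast hn
    have hsn : 0 < Real.sqrt n := Real.sqrt_pos.2 hn'
    rw [lt_div_iff₀ hn'] at hfn
    set N : Ω n → ℝ := fun x => ∑ i, s.indicator (fun _ => (1 : ℝ)) (X n i x) with hN
    set W : Ω n → ℝ := fun x => ∑ i, s.indicator (fun e => y e - c) (X n i x) with hW
    -- With `|W| < a` and `N > n * (p / 2)`, the ratio satisfies `√n * (W / N) ^ 2 ≤ r`.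
    set a : ℝ := n * (p / 2) * Real.sqrt (r / Real.sqrt n) with ha
    have ha0 : 0 < a := by positivity
    have hasq : a ^ 2 * Real.sqrt n = r * (n * (p / 2)) ^ 2 := by
      rw [ha, mul_pow, Real.sq_sqrt (by positivity)]
      field_simp
    have hA : (Pr n).real {x | n * p / 4 ≤ |N x - ∑ i, (Q n i).real s|} ≤
        16 / p ^ 2 * (n : ℝ)⁻¹ := by
      have hind1 : Measurable (s.indicator (fun _ : E => (1 : ℝ))) :=
        measurable_const.indicator hs
      have hc := measureReal_abs_sum_sub_ge_le (hind n) (hlaw n) hind1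
        (fun i => (memLp_const (1 : ℝ)).indicator hs) (B := 1) (fun i => ?_)
        (show 0 < n * p / 4 by positivity)
      · simp only [integral_indicator_const _ hs, smul_eq_mul, mul_one] at hc
        refine hc.trans (le_of_eq ?_)
        field_simp
        norm_num
      · have hsq : ∀ e, s.indicator (fun _ : E => (1 : ℝ)) e ^ 2
            = s.indicator (fun _ : E => (1 : ℝ)) e := fun e => by
          by_cases he : e ∈ s <;> simp [he]
        simp only [hsq, integral_indicator_const _ hs, smul_eq_mul, mul_one]
        exact measureReal_le_one
    have hBd : (Pr n).real {x | a ≤ |W x|} ≤ 4 * B / (r * p ^ 2) * (Real.sqrt n)⁻¹ := by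
      have hc := measureReal_abs_sum_sub_ge_le (hind n) (hlaw n)
        ((hy.sub_const c).indicator hs) (hmem n) (hvar n) ha0
      simp only [hmean, Finset.sum_const_zero, sub_zero] at hc
      refine hc.trans (le_of_eq ?_)
      have : a ^ 2 = r * (n * (p / 2)) ^ 2 / Real.sqrt n := by
        rw [← hasq]; field_simp
      rw [this]
      have hss : Real.sqrt n * Real.sqrt n = n := Real.mul_self_sqrt hn'.le
      field_simp
      rw [sq (√(n : ℝ)), hss]; ring
    have hsub : {x | r < Real.sqrt n * (cellMean s y (fun i => X n i x) - c) ^ 2} ⊆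
        {x | n * p / 4 ≤ |N x - ∑ i, (Q n i).real s|} ∪ {x | a ≤ |W x|} := by
      intro x hx
      by_contra hcon
      simp only [Set.mem_union, Set.mem_ofPred_eq, not_or, not_le] at hcon hx
      obtain ⟨h1, h2⟩ := hcon
      have hNx : n * (p / 2) < N x := by
        have := (abs_lt.1 h1).1
        linarith
      have hNpos : 0 < N x := lt_trans (by positivity) hNx
      rw [cellMean_sub c hNpos.ne', div_pow, mul_div_assoc', lt_div_iff₀ (by positivity)] at hx
      have hWsq : W x ^ 2 ≤ a ^ 2 := by
        rw [← sq_abs]; exact pow_le_pow_left₀ (abs_nonneg _) h2.le 2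
      have hNsq : (n * (p / 2)) ^ 2 ≤ N x ^ 2 := pow_le_pow_left₀ (by positivity) hNx.le 2
      have h3 : Real.sqrt n * W x ^ 2 ≤ Real.sqrt n * a ^ 2 := by gcongr
      have h4 : r * (n * (p / 2)) ^ 2 ≤ r * N x ^ 2 := by gcongr
      have h5 : r * N x ^ 2 < Real.sqrt n * W x ^ 2 := hx
      linarith
    exact (measureReal_mono hsub).trans ((measureReal_union_le _ _).trans (add_le_add hA hBd))
  refine squeeze_zero' (Eventually.of_forall fun _ => measureReal_nonneg) hmain ?_
  have h1 : Tendsto (fun n : ℕ => (n : ℝ)⁻¹) atTop (𝓝 0) := tendsto_inv_atTop_nhds_zero_nat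
  have h2 : Tendsto (fun n : ℕ => (Real.sqrt n)⁻¹) atTop (𝓝 0) :=
    tendsto_inv_atTop_zero.comp (Real.tendsto_sqrt_atTop.comp tendsto_natCast_atTop_atTop)
  simpa using (h1.const_mul (16 / p ^ 2)).add (h2.const_mul (4 * B / (r * p ^ 2)))

/-! ### Population moments of a cell -/

/-- The conditional mean is the integral over `s` divided by the mass of `s`, so centring there
makes the integral over `s` cancel. -/
lemma integral_indicator_sub_integral_cond {I : Type*} [MeasurableSpace I] (ν : Measure I)
    [IsProbabilityMeasure ν] {s : Set I} (hs : MeasurableSet s) (hpos : 0 < ν.real s) {f : I → ℝ}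
    (hf : Integrable f ν) :
    ∫ x, s.indicator (fun x => f x - ∫ z, f z ∂(cond ν s)) x ∂ν = 0 := by
  have hc : ∫ z, f z ∂(cond ν s) = (ν.real s)⁻¹ * ∫ z in s, f z ∂ν := by
    rw [ProbabilityTheory.cond, integral_smul_measure, ENNReal.toReal_inv, smul_eq_mul]; rfl
  rw [integral_indicator hs, integral_sub hf.integrableOn (integrable_const _),
    setIntegral_const, hc, smul_eq_mul, mul_inv_cancel_left₀ hpos.ne', sub_self]

lemma memLp_indicator_sub_const {E : Type*} [MeasurableSpace E] {Q : Measure E}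
    [IsFiniteMeasure Q] {s : Set E} (hs : MeasurableSet s) {y : E → ℝ} (hy : Measurable y)
    (hy2 : Integrable (fun e => y e ^ 2) Q) (c : ℝ) :
    MemLp (s.indicator fun e => y e - c) 2 Q :=
  (((memLp_two_iff_integrable_sq hy.aestronglyMeasurable).2 hy2).sub (memLp_const c)).indicator hs

lemma tendsto_const_freq (p : ℝ) :
    Tendsto (fun n : ℕ => (∑ _i : Fin n, p) / n) atTop (𝓝 p) := by
  refine tendsto_const_nhds.congr' ?_
  filter_upwards [eventually_gt_atTop 0] with n hn
  have hn' : (n : ℝ) ≠ 0 := by exact_mod_cast hn.ne'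
  simp [mul_div_cancel_left₀ _ hn']

/-! ### Panel data -/

lemma measurable_panelObserve : Measurable (panelObserve (J := J) (m := m)) := by
  refine Measurable.prodMk (measurable_pi_lambda _ fun t => ?_) measurable_snd.snd
  refine Measurable.ite ?_ ((measurable_pi_apply t).comp measurable_snd.fst)
    ((measurable_pi_apply t).comp measurable_fst)
  exact measurable_snd.snd (MeasurableSet.of_discrete (s := {k | IsTreated k t}))

instance (P : Measure (PanelInd J m)) [IsProbabilityMeasure P] :
    IsProbabilityMeasure (panelLaw P) :=
  Measure.isProbabilityMeasure_map measurable_panelObserve.aemeasurable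

lemma measurableSet_panelCell (k : AggUnit J) : MeasurableSet {e : PanelObs J m | e.2 = k} :=
  measurable_snd (measurableSet_singleton k)

lemma measurableSet_panelIndCell (k : AggUnit J) : MeasurableSet {x : PanelInd J m | x.2.2 = k} :=
  measurable_snd.snd (measurableSet_singleton k)

lemma measurable_panelOutcome (t : Period m) : Measurable fun e : PanelObs J m => e.1 t :=
  (measurable_pi_apply t).comp measurable_fst

lemma panelMeanHat_eq_cellMean {n : ℕ} (x : Fin n → PanelObs J m) (k : AggUnit J) (t : Period m) :
    panelMeanHat x k t = cellMean {e : PanelObs J m | e.2 = k} (fun e => e.1 t) x := by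
  simp only [panelMeanHat, cellMean, Set.mem_ofPred_eq]
  congr!

/-- Given the unit, treatment status depends only on the cell, so the realized outcome agrees almost
surely with a single potential outcome. -/
lemma obsMean_panel (P : Measure (PanelInd J m)) [IsProbabilityMeasure P] (k : AggUnit J)
    (t : Period m) : obsMean (panelMean0 P) (panelMean1 P) k t =
      ∫ x, (panelObserve x).1 t ∂(cond P {x | x.2.2 = k}) := by
  have hae : ∀ᵐ x ∂(cond P {x | x.2.2 = k}), (panelObserve x).1 t =
      if IsTreated k t then x.2.1 t else x.1 t := by
    filter_upwards [ae_cond_mem (μ := P) (measurableSet_panelIndCell k)] with x hx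
    have hx' : x.2.2 = k := hx
    simp [panelObserve, hx']
  rw [integral_congr_ae hae, obsMean]
  split_ifs <;> rfl

lemma integral_panelCell (P : Measure (PanelInd J m)) [IsProbabilityMeasure P] (k : AggUnit J)
    (t : Period m) (hpos : 0 < P.real {x | x.2.2 = k})
    (hint : Integrable (fun e => e.1 t) (panelLaw P)) :
    ∫ e, {e : PanelObs J m | e.2 = k}.indicator
      (fun e => e.1 t - obsMean (panelMean0 P) (panelMean1 P) k t) e ∂(panelLaw P) = 0 := by
  rw [obsMean_panel, panelLaw, integral_map measurable_panelObserve.aemeasurable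
    (((measurable_panelOutcome t).sub_const _).indicator
      (measurableSet_panelCell k)).aestronglyMeasurable]
  exact integral_indicator_sub_integral_cond P (measurableSet_panelIndCell k) hpos
    (hint.comp_measurable measurable_panelObserve)

theorem coversPointwise_panelCS {α ς ε : ℝ} (hα1 : α < 1) (hς0 : 0 < ς) (hςα : ς < α) (hε : 0 < ε)
    (P : Measure (PanelInd J m)) [IsProbabilityMeasure P]
    (hp : ∀ k, ε ≤ P.real {x | x.2.2 = k})
    (h2 : ∀ t, Integrable (fun y => y.1 t ^ 2) (panelLaw P))
    {Ω : ℕ → Type*} [∀ n, MeasurableSpace (Ω n)] (Pr : ∀ n, Measure (Ω n))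
    [∀ n, IsProbabilityMeasure (Pr n)] (X : ∀ n, Fin n → Ω n → PanelObs J m)
    (hX : ∀ n, IsIIDSample (Pr n) (X n) (panelLaw P)) :
    CoversPointwise Pr (fun n x => panelCS P α ς n (fun i => X n i x))
      (effectSet (panelMean0 P) (panelMean1 P)) (1 - α) := by
  refine coversPointwise_confSet (panelCov P) hα1 hς0 hςα Pr
    (fun n x => panelMeanHat (fun i => X n i x)) fun k t r hr => ?_
  simp only [panelMeanHat_eq_cellMean]
  have hreal : (panelLaw P).real {e | e.2 = k} = P.real {x | x.2.2 = k} :=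
    map_measureReal_apply measurable_panelObserve (measurableSet_panelCell k)
  have hpos : 0 < P.real {x | x.2.2 = k} := hε.trans_le (hp k)
  refine tendsto_measureReal_cellMean Pr (Q := fun _ _ => panelLaw P) (fun n => (hX n).1)
    (fun n => (hX n).2) (measurableSet_panelCell k) (measurable_panelOutcome t)
    (p := (panelLaw P).real {e | e.2 = k}) (hreal ▸ hpos)
    (fun _ _ => memLp_indicator_sub_const (measurableSet_panelCell k) (measurable_panelOutcome t)
      (h2 t) _)
    -- With identical laws, `B` is the common second moment and the expected cell frequency is
    -- constant in `n`.
    (fun _ _ => integral_panelCell P k t hpos ?_) (fun _ _ => le_rfl) (tendsto_const_freq _) hr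
  exact ((memLp_two_iff_integrable_sq (measurable_panelOutcome t).aestronglyMeasurable).2
    (h2 t)).integrable one_le_two

/-! ### Repeated cross-sections -/

lemma measurable_rcsObserve (t : Period m) : Measurable (rcsObserve (J := J) t) := by
  refine Measurable.prodMk ?_ (measurable_snd.snd.prodMk measurable_const)
  refine Measurable.ite ?_ measurable_snd.fst measurable_fst
  exact measurable_snd.snd (MeasurableSet.of_discrete (s := {k | IsTreated k t}))

/-- Distribution of an observation of an individual in period `t`. -/
noncomputable abbrev rcsPeriodLaw (P : Period m → Measure (RCSInd J)) (t : Period m) :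
    Measure (RCSObs J m) :=
  (P t).map (rcsObserve t)

instance (P : Period m → Measure (RCSInd J)) [∀ t, IsProbabilityMeasure (P t)] (t : Period m) :
    IsProbabilityMeasure (rcsPeriodLaw P t) :=
  Measure.isProbabilityMeasure_map (measurable_rcsObserve t).aemeasurable

lemma measurableSet_rcsCell (c : AggUnit J × Period m) :
    MeasurableSet {e : RCSObs J m | e.2 = c} :=
  measurable_snd (measurableSet_singleton c)

lemma measurableSet_rcsIndCell (k : AggUnit J) : MeasurableSet {x : RCSInd J | x.2.2 = k} :=
  measurable_snd.snd (measurableSet_singleton k)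

lemma measurable_rcsOutcome : Measurable fun e : RCSObs J m => e.1 := measurable_fst

lemma rcsMeanHat_eq_cellMean {n : ℕ} (x : Fin n → RCSObs J m) (k : AggUnit J) (t : Period m) :
    rcsMeanHat x k t = cellMean {e : RCSObs J m | e.2 = (k, t)} (fun e => e.1) x := by
  simp only [rcsMeanHat, cellMean, Set.mem_ofPred_eq]
  congr!

lemma obsMean_rcs (P : Period m → Measure (RCSInd J)) [∀ t, IsProbabilityMeasure (P t)]
    (k : AggUnit J) (t : Period m) : obsMean (rcsMean0 P) (rcsMean1 P) k t =
      ∫ x, (rcsObserve t x).1 ∂(cond (P t) {x | x.2.2 = k}) := by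
  have hae : ∀ᵐ x ∂(cond (P t) {x | x.2.2 = k}), (rcsObserve t x).1 =
      if IsTreated k t then x.2.1 else x.1 := by
    filter_upwards [ae_cond_mem (μ := P t) (measurableSet_rcsIndCell k)] with x hx
    have hx' : x.2.2 = k := hx
    simp [rcsObserve, hx']
  rw [integral_congr_ae hae, obsMean]
  split_ifs <;> rfl

lemma rcsPeriodLaw_real_cell (P : Period m → Measure (RCSInd J)) (k : AggUnit J)
    (t t' : Period m) : (rcsPeriodLaw P t').real {e | e.2 = (k, t)} =
      if t' = t then (P t).real {x | x.2.2 = k} else 0 := by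
  rw [rcsPeriodLaw, map_measureReal_apply (measurable_rcsObserve t') (measurableSet_rcsCell _)]
  split_ifs with h
  · subst h
    congr 1
    ext x
    simp [rcsObserve]
  · have : rcsObserve t' ⁻¹' {e : RCSObs J m | e.2 = (k, t)} = ∅ := by
      ext x
      simp [rcsObserve, h]
    rw [this, measureReal_empty]

/-- In stratum `t` this is centring at the conditional mean; in any other stratum the cell is never
hit and the integrand is zero. Centring thus holds observation by observation, as fixed strata
require. -/
lemma integral_rcsCell (P : Period m → Measure (RCSInd J)) [∀ t, IsProbabilityMeasure (P t)]
    (k : AggUnit J) (t t' : Period m) (hpos : 0 < (P t).real {x | x.2.2 = k})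
    (hint : Integrable (fun e => e.1) (rcsPeriodLaw P t)) :
    ∫ e, {e : RCSObs J m | e.2 = (k, t)}.indicator
      (fun e => e.1 - obsMean (rcsMean0 P) (rcsMean1 P) k t) e ∂(rcsPeriodLaw P t') = 0 := by
  rw [rcsPeriodLaw, integral_map (measurable_rcsObserve t').aemeasurable
    ((measurable_rcsOutcome.sub_const _).indicator (measurableSet_rcsCell _)).aestronglyMeasurable]
  by_cases h : t' = t
  · subst h
    rw [obsMean_rcs, ← integral_indicator_sub_integral_cond (P t') (measurableSet_rcsIndCell k)
      hpos (hint.comp_measurable (measurable_rcsObserve t'))]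
    congr 1
    funext x
    simp [Set.indicator, rcsObserve]
  · simp [Set.indicator, rcsObserve, h]

lemma isProbabilityMeasure_rcsLaw {π : Period m → ℝ} (hπ : π ∈ stdSimplex ℝ (Period m))
    (P : Period m → Measure (RCSInd J)) [∀ t, IsProbabilityMeasure (P t)] :
    IsProbabilityMeasure (rcsLaw π P) := by
  constructor
  have h : ∀ t, (rcsPeriodLaw P t) Set.univ = 1 := fun t => measure_univ
  simp only [rcsPeriodLaw] at h
  simp [rcsLaw, h, ← ENNReal.ofReal_sum_of_nonneg (fun t _ => hπ.1 t), hπ.2]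

/-- A stratum with positive share is, up to a finite nonzero factor, one summand of the pooled law.
-/
lemma integrable_rcsPeriodLaw {π : Period m → ℝ} (P : Period m → Measure (RCSInd J))
    {f : RCSObs J m → ℝ} (hf : Integrable f (rcsLaw π P)) {t : Period m} (ht : 0 < π t) :
    Integrable f (rcsPeriodLaw P t) := by
  rw [rcsLaw, integrable_finsetSum_measure] at hf
  exact (integrable_smul_measure (ENNReal.ofReal_pos.2 ht).ne' ENNReal.ofReal_ne_top).1
    (hf t (Finset.mem_univ t))

lemma rcsLaw_real_cell {π : Period m → ℝ} (hπ : ∀ t, 0 ≤ π t) (P : Period m → Measure (RCSInd J))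
    [∀ t, IsProbabilityMeasure (P t)] (k : AggUnit J) (t : Period m) :
    (rcsLaw π P).real {e | e.2 = (k, t)} = π t * (P t).real {x | x.2.2 = k} := by
  have h (t') := rcsPeriodLaw_real_cell P k t t'
  simp only [measureReal_def] at h ⊢
  rw [rcsLaw, Measure.finsetSum_apply, ENNReal.toReal_sum fun t' _ => by
    simpa using ENNReal.mul_ne_top ENNReal.ofReal_ne_top (measure_ne_top (rcsPeriodLaw P t') _)]
  simp [ENNReal.toReal_mul, ENNReal.toReal_ofReal (hπ _), h]

lemma integral_rcsLaw_cell {π : Period m → ℝ} (P : Period m → Measure (RCSInd J))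
    [∀ t, IsProbabilityMeasure (P t)] (k : AggUnit J) (t : Period m)
    (hpos : 0 < (P t).real {x | x.2.2 = k})
    (hint : ∀ t', Integrable (fun e => e.1) (rcsPeriodLaw P t')) :
    ∫ e, {e : RCSObs J m | e.2 = (k, t)}.indicator
      (fun e => e.1 - obsMean (rcsMean0 P) (rcsMean1 P) k t) e ∂(rcsLaw π P) = 0 := by
  rw [rcsLaw, integral_finsetSum_measure]
  · refine Finset.sum_eq_zero fun t' _ => ?_
    rw [integral_smul_measure, integral_rcsCell P k t t' hpos (hint t), smul_zero]
  · intro t' _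
    exact (((hint t').sub (integrable_const _)).indicator
      (measurableSet_rcsCell _)).smul_measure ENNReal.ofReal_ne_top

theorem coversPointwise_rcsCS {α ς ε : ℝ} (hα1 : α < 1) (hς0 : 0 < ς) (hςα : ς < α) (hε : 0 < ε)
    {π : Period m → ℝ} (P : Period m → Measure (RCSInd J)) [∀ t, IsProbabilityMeasure (P t)]
    (hπ : π ∈ stdSimplex ℝ (Period m)) (hp : ∀ k t, ε ≤ π t * (P t).real {x | x.2.2 = k})
    (h2 : Integrable (fun y => y.1 ^ 2) (rcsLaw π P))
    {Ω : ℕ → Type*} [∀ n, MeasurableSpace (Ω n)] (Pr : ∀ n, Measure (Ω n))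
    [∀ n, IsProbabilityMeasure (Pr n)] (X : ∀ n, Fin n → Ω n → RCSObs J m)
    (hX : (∀ n, IsIIDSample (Pr n) (X n) (rcsLaw π P)) ∨
      ∃ T : ∀ n, Fin n → Period m,
        (∀ t, Tendsto (fun n : ℕ => (Finset.card {i | T n i = t} : ℝ) / n) atTop (𝓝 (π t))) ∧
        ∀ n, IsStratifiedSample (Pr n) (X n) (T n) P) :
    CoversPointwise Pr (fun n x => rcsCS π P α ς n (fun i => X n i x))
      (effectSet (rcsMean0 P) (rcsMean1 P)) (1 - α) := by
  refine coversPointwise_confSet (rcsCov π P) hα1 hς0 hςα Pr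
    (fun n x => rcsMeanHat (fun i => X n i x)) fun k t r hr => ?_
  simp only [rcsMeanHat_eq_cellMean]
  have hcell : ∀ t, 0 < π t * (P t).real {x | x.2.2 = k} := fun t => hε.trans_le (hp k t)
  have hπ0 : ∀ t, 0 < π t := fun t => pos_of_mul_pos_left (hcell t) measureReal_nonneg
  have hpos : 0 < (P t).real {x | x.2.2 = k} := pos_of_mul_pos_right (hcell t) (hπ.1 t)
  have hsq : ∀ t, Integrable (fun y => y.1 ^ 2) (rcsPeriodLaw P t) := fun t =>
    integrable_rcsPeriodLaw P h2 (hπ0 t)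
  have hint : ∀ t, Integrable (fun y => y.1) (rcsPeriodLaw P t) := fun t =>
    ((memLp_two_iff_integrable_sq measurable_rcsOutcome.aestronglyMeasurable).2
      (hsq t)).integrable one_le_two
  rcases hX with hX | ⟨T, hT, hX⟩
  · have := isProbabilityMeasure_rcsLaw hπ P
    exact tendsto_measureReal_cellMean Pr (Q := fun _ _ => rcsLaw π P) (fun n => (hX n).1)
      (fun n => (hX n).2) (measurableSet_rcsCell (k, t)) measurable_rcsOutcome
      (p := (rcsLaw π P).real {e | e.2 = (k, t)}) (by rw [rcsLaw_real_cell hπ.1]; exact hcell t)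
      (fun _ _ => memLp_indicator_sub_const (measurableSet_rcsCell _) measurable_rcsOutcome h2 _)
      (fun _ _ => integral_rcsLaw_cell P k t hpos hint) (fun _ _ => le_rfl)
      (tendsto_const_freq _) hr
  -- Summing over the finitely many strata gives one bound valid for every observation, whatever its
  -- period.
  · set B : ℝ := ∑ t', ∫ e, {e : RCSObs J m | e.2 = (k, t)}.indicator
      (fun e => e.1 - obsMean (rcsMean0 P) (rcsMean1 P) k t) e ^ 2 ∂(rcsPeriodLaw P t')
    refine tendsto_measureReal_cellMean Pr (Q := fun n i => rcsPeriodLaw P (T n i)) (B := B)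
      (fun n => (hX n).1) (fun n => (hX n).2) (measurableSet_rcsCell (k, t)) measurable_rcsOutcome
      (hcell t)
      (fun n i => memLp_indicator_sub_const (measurableSet_rcsCell _) measurable_rcsOutcome
        (hsq (T n i)) _)
      (fun n i => integral_rcsCell P k t (T n i) hpos (hint t)) (fun n i => ?_) ?_ hr
    · exact Finset.single_le_sum (f := fun t' => ∫ e, {e : RCSObs J m | e.2 = (k, t)}.indicator
        (fun e => e.1 - obsMean (rcsMean0 P) (rcsMean1 P) k t) e ^ 2 ∂(rcsPeriodLaw P t'))
        (fun t' _ => integral_nonneg fun _ => sq_nonneg _) (Finset.mem_univ (T n i))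
    -- Only observations of period `t` can fall in the cell, so the expected frequency is the share
    -- of that stratum times the unit's probability within it.
    · refine ((hT t).mul_const ((P t).real {x | x.2.2 = k})).congr fun n => ?_
      simp only [rcsPeriodLaw_real_cell]
      rw [← Finset.sum_filter, Finset.sum_const, nsmul_eq_mul]
      ring

end SynthPT

theorem theorem1 (J m : ℕ) (α ς ε C : ℝ) (hα0 : 0 < α) (hα1 : α < 1) (hς0 : 0 < ς)
    (hςα : ς < α) (hε : 0 < ε) :
    -- panel data
    (∀ (P : Measure (PanelInd J m)) [IsProbabilityMeasure P],
      (∀ k, ε ≤ P.real {x | x.2.2 = k}) →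
      (∀ k t, Integrable (fun x => x.1 t) (cond P {x | x.2.2 = k})) →
      SyntheticParallelTrends (panelMean0 P) →
      (∀ t, Integrable (fun y => y.1 t ^ 2) (panelLaw P) ∧
        0 < ∫ y, y.1 t ^ 2 ∂(panelLaw P) ∧ ∫ y, y.1 t ^ 2 ∂(panelLaw P) < C) →
      ∀ {Ω : ℕ → Type*} [∀ n, MeasurableSpace (Ω n)] (Pr : ∀ n, Measure (Ω n))
        [∀ n, IsProbabilityMeasure (Pr n)] (X : ∀ n, Fin n → Ω n → PanelObs J m),
        (∀ n, IsIIDSample (Pr n) (X n) (panelLaw P)) →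
        CoversPointwise Pr (fun n x => panelCS P α ς n (fun i => X n i x))
          (effectSet (panelMean0 P) (panelMean1 P)) (1 - α)) ∧
    -- repeated cross-sections, with random periods or with fixed strata
    (∀ (π : Period m → ℝ) (P : Period m → Measure (RCSInd J)) [∀ t, IsProbabilityMeasure (P t)],
      π ∈ stdSimplex ℝ (Period m) →
      (∀ k t, ε ≤ π t * (P t).real {x | x.2.2 = k}) →
      (∀ k t, Integrable (fun x => x.1) (cond (P t) {x | x.2.2 = k})) →
      SyntheticParallelTrends (rcsMean0 P) →
      Integrable (fun y => y.1 ^ 2) (rcsLaw π P) →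
      0 < ∫ y, y.1 ^ 2 ∂(rcsLaw π P) →
      ∫ y, y.1 ^ 2 ∂(rcsLaw π P) < C →
      ∀ {Ω : ℕ → Type*} [∀ n, MeasurableSpace (Ω n)] (Pr : ∀ n, Measure (Ω n))
        [∀ n, IsProbabilityMeasure (Pr n)] (X : ∀ n, Fin n → Ω n → RCSObs J m),
        ((∀ n, IsIIDSample (Pr n) (X n) (rcsLaw π P)) ∨
          ∃ T : ∀ n, Fin n → Period m,
            (∀ t, Tendsto (fun n : ℕ => (Finset.card {i | T n i = t} : ℝ) / n) atTop (𝓝 (π t))) ∧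
            ∀ n, IsStratifiedSample (Pr n) (X n) (T n) P) →
        CoversPointwise Pr (fun n x => rcsCS π P α ς n (fun i => X n i x))
          (effectSet (rcsMean0 P) (rcsMean1 P)) (1 - α)) := by
  refine ⟨fun P _ hp _ _ h2 Ω _ Pr _ X hX => ?_, fun π P _ hπ hp _ _ h2 _ _ Ω _ Pr _ X hX => ?_⟩
  · exact coversPointwise_panelCS hα1 hς0 hςα hε P hp (fun t => (h2 t).1) Pr X hX
  · exact coversPointwise_rcsCS hα1 hς0 hςα hε P hπ hp h2 Pr X hX
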